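/- Let $d,r\in\mathbb N$, let $M\subseteq\mathbb R^d$ be compact, convex and full-dimensional (nonempty interior), and write $B(z;\epsilon)$ for the closed Euclidean ball. For a nonempty $J\subseteq[r]=\{1,\dots,r\}$ and $x=(x_1,\dots,x_r)\in(\mathbb R^d)^r$ let $$\phi[J](x)=\inf\Big\{\epsilon>0 : \bigcap_{j\in J}B(x_j;\epsilon)\neq\emptyset\Big\}$$ be the Čech filtration function. For each $x$ let $u_1<\dots<u_L$ be the different values of $\phi[J](x)$, $\emptyset\ne J\subseteq[r]$, and choose nonempty $J_1,\dots,J_L\subseteq[r]$ (depending on $x$) such that $J_l$ is minimal with respect to inclusion among the nonempty $J$ with $\phi[J](x)=u_l$. Put $$\rho(x)=\sup\Big\{\epsilon\ge 0 : \phi[J_1](y)<\dots<\phi[J_L](y)\ \text{ for all } y\in \prod_{i=1}^r B(x_i;\epsilon)\Big\}\in[0,\infty].$$ Then there is a constant $C<\infty$, depending only on $d$, $r$ and $M$ (not on the choice of the sets $J_l$), such that $$\lambda^{dr}\big(\{x\in M^r : \rho(x)\le t\}\big)\le C\sqrt t\qquad\text{for all } t\in[0,1],$$ where $\lambda^{dr}$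 is the Lebesgue measure on $(\mathbb R^d)^r$. That is, the sublevel sets of $\rho$ satisfy the bound $\lambda^{dr}(\{x\in M^r:\rho(x)\le t\})\lesssim t^\alpha$, $t\in[0,1]$, with $\alpha=1/2$. -/

import Mathlib

open scoped ENNReal NNReal

/-- The Čech filtration function on point clouds of size `r` in `ℝᵈ`: the filtration time of the
simplex with vertices `x j`, `j ∈ J`, is the infimum of all `ε > 0` for which the closed Euclidean
balls of radius `ε` around these vertices have a common point. (Used for nonempty `J` only.) -/
noncomputable def cechFiltration {d r : ℕ} (J : Finset (Fin r))
    (x : Fin r → EuclideanSpace ℝ (Fin d)) : ℝ :=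
  sInf {ε : ℝ | 0 < ε ∧ (⋂ j ∈ J, Metric.closedBall (x j) ε).Nonempty}

/-- Representatives of the filtration order at the point cloud `x`. The family `J` lists
nonempty index sets whose filtration times `φ (J 0) x < φ (J 1) x < ⋯` are all the different values
that `φ` takes at `x` on nonempty index sets, and every `J l` is minimal with respect to
inclusion among the nonempty index sets with the same filtration time.
The field `L` is then the number of different values. -/
structure FiltrationOrder {d r : ℕ}
    (φ : Finset (Fin r) → (Fin r → EuclideanSpace ℝ (Fin d)) → ℝ)
    (x : Fin r → EuclideanSpace ℝ (Fin d)) where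
  L : ℕ
  J : Fin L → Finset (Fin r)
  strictMono : StrictMono fun l => φ (J l) x
  exhaustive : ∀ I : Finset (Fin r), I.Nonempty → ∃ l, φ (J l) x = φ I x
  minimal : ∀ l, Minimal (fun I : Finset (Fin r) => I.Nonempty ∧ φ I x = φ (J l) x) (J l)

/-- Such representatives always exist (they need not be unique, e.g. when several
singletons have the same filtration time). -/
theorem FiltrationOrder.nonempty {d r : ℕ}
    (φ : Finset (Fin r) → (Fin r → EuclideanSpace ℝ (Fin d)) → ℝ)
    (x : Fin r → EuclideanSpace ℝ (Fin d)) : Nonempty (FiltrationOrder φ x) := by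
  classical
  let V : Finset ℝ :=
    (Finset.univ.filter fun I : Finset (Fin r) => I.Nonempty).image fun I => φ I x
  have key : ∀ l : Fin V.card, ∃ K : Finset (Fin r),
      Minimal (fun I : Finset (Fin r) => I.Nonempty ∧ φ I x = V.orderEmbOfFin rfl l) K := by
    intro l
    have hl : V.orderEmbOfFin rfl l ∈ V := V.orderEmbOfFin_mem rfl l
    obtain ⟨I, hI, hv⟩ := Finset.mem_image.1 hl
    obtain ⟨K, -, hK⟩ := exists_minimal_le_of_wellFoundedLT
      (fun I : Finset (Fin r) => I.Nonempty ∧ φ I x = V.orderEmbOfFin rfl l) I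
      ⟨(Finset.mem_filter.1 hI).2, hv⟩
    exact ⟨K, hK⟩
  choose K hK using key
  have hval : ∀ l, φ (K l) x = V.orderEmbOfFin rfl l := fun l => (hK l).1.2
  refine ⟨⟨V.card, K, ?_, ?_, ?_⟩⟩
  · intro a b hab
    simp only [hval]
    exact (V.orderEmbOfFin rfl).strictMono hab
  · intro I hI
    have hmem : φ I x ∈ V :=
      Finset.mem_image.2 ⟨I, Finset.mem_filter.2 ⟨Finset.mem_univ _, hI⟩, rfl⟩
    have hr : φ I x ∈ Set.range (V.orderEmbOfFin rfl) := by
      rw [Finset.range_orderEmbOfFin]; exact hmem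
    obtain ⟨l, hl⟩ := hr
    exact ⟨l, (hval l).trans hl⟩
  · intro l
    rw [hval l]
    exact hK l

/-- The stability radius `ρ(x)`: the supremum of all `ε ≥ 0` such that the strict order
`φ (J 0) y < φ (J 1) y < ⋯` of the representatives chosen at `x` persists for all point clouds `y`
with `‖y i - x i‖ ≤ ε` for every `i`. The supremum is taken in `[0, ∞]`; it is infinite if `φ`
has at most one value at `x`, since there is then no order to be destroyed. -/
noncomputable def stabilityRadius {d r : ℕ}
    (φ : Finset (Fin r) → (Fin r → EuclideanSpace ℝ (Fin d)) → ℝ)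
    (x : Fin r → EuclideanSpace ℝ (Fin d)) (S : FiltrationOrder φ x) : ℝ≥0∞ :=
  ⨆ (ε : ℝ≥0) (_ : ∀ y : Fin r → EuclideanSpace ℝ (Fin d),
    (∀ i, y i ∈ Metric.closedBall (x i) (ε : ℝ)) → StrictMono fun l => φ (S.J l) y), (ε : ℝ≥0∞)

/-! ### Smallest enclosing balls and tight simplices -/

section Cech

variable {d r : ℕ}

/-! Each filtration time is 1-Lipschitz, so `ρ(x) ≤ t` forces two representatives `I`, `J` whose
times differ by at most `2t`. Minimality makes both tight: all vertices lie on the boundary of the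
smallest enclosing ball, whose center is in their convex hull (`isTight_of_minimal`). Name them so
that `J` is at least as large as `I`, and pick `k ∈ J \ I`.

Now move only `x k`. The time of `I` is frozen, so the radius `R` for `J` stays in an interval of
length `O(t)`. Let `c`, `ρ` be the circumcenter and circumradius of the other vertices of `J`, `W`
the direction of their span, `P` the projection onto `Wᗮ`, and `s = √(R² - ρ²)`. Tightness gives `‖x
k - c‖² - 2 s ‖P (x k - c)‖ = ρ²` (`IsTight.exists_radial_eq`). On each ray from `c` the distance to
`c` is thus a 2-Lipschitz function of `s`, while `s` is only 1/2-Hölder in `R`, which is where `√t`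
comes from. Polar coordinates around `c`, Fubini and a union over the finitely many `(I, J, k)`
finish the proof. -/

theorem exists_isLeast_enclosing {J : Finset (Fin r)} (hJ : J.Nonempty)
    (x : Fin r → EuclideanSpace ℝ (Fin d)) :
    ∃ z, (∀ j ∈ J, dist (x j) z ≤ cechFiltration J x) ∧
      ∀ y ε, (∀ j ∈ J, dist (x j) y ≤ ε) → cechFiltration J x ≤ ε := by
  obtain ⟨j₀, hj₀⟩ := hJ
  set F : EuclideanSpace ℝ (Fin d) → ℝ := fun z => J.sup' ⟨j₀, hj₀⟩ fun j => dist (x j) z with hF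
  have hFc : Continuous F :=
    Continuous.finset_sup'_apply _ fun j _ => continuous_const.dist continuous_id
  have hFt : Filter.Tendsto F (Filter.cocompact _) Filter.atTop :=
    Filter.tendsto_atTop_mono
      (fun z => Finset.le_sup' (f := fun j => dist (x j) z) hj₀)
      (tendsto_dist_left_cocompact_atTop (x j₀))
  obtain ⟨z, hz⟩ := hFc.exists_forall_le hFt
  have hle : ∀ j ∈ J, dist (x j) z ≤ F z := fun j hj =>
    Finset.le_sup' (f := fun j => dist (x j) z) hj
  have hz0 : 0 ≤ F z := dist_nonneg.trans (hle j₀ hj₀)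
  have hmem : ∀ y ε, (∀ j ∈ J, dist (x j) y ≤ ε) → F z ≤ ε := fun y ε h =>
    (hz y).trans (Finset.sup'_le _ _ h)
  have hval : cechFiltration J x = F z := by
    unfold cechFiltration
    apply le_antisymm
    · refine le_of_forall_pos_le_add fun ε hε => csInf_le ⟨0, fun _ h => h.1.le⟩
        ⟨by linarith, z, ?_⟩
      simp only [Set.mem_iInter, Metric.mem_closedBall']
      exact fun j hj => (hle j hj).trans (by linarith)
    · refine le_csInf ⟨F z + 1, by linarith, z, ?_⟩ ?_
      · simp only [Set.mem_iInter, Metric.mem_closedBall']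
        exact fun j hj => (hle j hj).trans (by linarith)
      · rintro ε ⟨-, y, hy⟩
        simp only [Set.mem_iInter, Metric.mem_closedBall'] at hy
        exact hmem y ε hy
  rw [hval]
  exact ⟨z, hle, hmem⟩

theorem cechFiltration_le_of_forall_dist_le {J : Finset (Fin r)} (hJ : J.Nonempty)
    {x : Fin r → EuclideanSpace ℝ (Fin d)} {y : EuclideanSpace ℝ (Fin d)} {ε : ℝ}
    (h : ∀ j ∈ J, dist (x j) y ≤ ε) : cechFiltration J x ≤ ε := by
  obtain ⟨z, -, hz⟩ := exists_isLeast_enclosing hJ x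
  exact hz y ε h

theorem cechFiltration_nonneg (J : Finset (Fin r)) (x : Fin r → EuclideanSpace ℝ (Fin d)) :
    0 ≤ cechFiltration J x :=
  Real.sInf_nonneg fun _ h => h.1.le

theorem cechFiltration_singleton (j : Fin r) (x : Fin r → EuclideanSpace ℝ (Fin d)) :
    cechFiltration {j} x = 0 :=
  le_antisymm (cechFiltration_le_of_forall_dist_le (Finset.singleton_nonempty j) (y := x j)
    (by simp)) (cechFiltration_nonneg _ _)

theorem cechFiltration_mono {I J : Finset (Fin r)} (hI : I.Nonempty) (hIJ : I ⊆ J)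
    (x : Fin r → EuclideanSpace ℝ (Fin d)) : cechFiltration I x ≤ cechFiltration J x := by
  obtain ⟨z, hz, -⟩ := exists_isLeast_enclosing (hI.mono hIJ) x
  exact cechFiltration_le_of_forall_dist_le hI fun j hj => hz j (hIJ hj)

theorem cechFiltration_le_add {J : Finset (Fin r)} (hJ : J.Nonempty)
    {x y : Fin r → EuclideanSpace ℝ (Fin d)} {ε : ℝ} (h : ∀ i, dist (x i) (y i) ≤ ε) :
    cechFiltration J x ≤ cechFiltration J y + ε := by
  obtain ⟨z, hz, -⟩ := exists_isLeast_enclosing hJ y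
  refine cechFiltration_le_of_forall_dist_le hJ (y := z) fun j hj => ?_
  linarith [dist_triangle (x j) (y j) z, hz j hj, h j]

theorem continuous_cechFiltration {J : Finset (Fin r)} (hJ : J.Nonempty) :
    Continuous (cechFiltration J : (Fin r → EuclideanSpace ℝ (Fin d)) → ℝ) := by
  refine (LipschitzWith.of_le_add fun x y => ?_).continuous
  exact cechFiltration_le_add hJ fun i => dist_le_pi_dist x y i

theorem cechFiltration_le_of_mem {J : Finset (Fin r)} (hJ : J.Nonempty)
    {x : Fin r → EuclideanSpace ℝ (Fin d)} {D : ℝ} (h : ∀ i j, dist (x i) (x j) ≤ D) :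
    cechFiltration J x ≤ D := by
  obtain ⟨j, -⟩ := id hJ
  exact cechFiltration_le_of_forall_dist_le hJ (y := x j) fun i _ => h i j

/-- The vertices `x j`, `j ∈ J`, all lie on the boundary of a ball of radius `cechFiltration J x`
whose center is in their convex hull. -/
def IsTight (J : Finset (Fin r)) (x : Fin r → EuclideanSpace ℝ (Fin d)) : Prop :=
  ∃ w ∈ stdSimplex ℝ (Fin r), (∀ i ∉ J, w i = 0) ∧
    ∀ j ∈ J, dist (x j) (∑ i, w i • x i) = cechFiltration J x

theorem exists_weights_of_mem_convexHull {E : Type*} [AddCommGroup E] [Module ℝ E]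
    (T : Finset (Fin r)) (x : Fin r → E)
    {z : E} (hz : z ∈ convexHull ℝ (x '' (T : Set (Fin r)))) :
    ∃ w ∈ stdSimplex ℝ (Fin r), (∀ i ∉ T, w i = 0) ∧ z = ∑ i, w i • x i := by
  let S : Set E := {z | ∃ w ∈ stdSimplex ℝ (Fin r), (∀ i ∉ T, w i = 0) ∧ z = ∑ i, w i • x i}
  have hS : Convex ℝ S := by
    rintro _ ⟨w, hw, hwT, rfl⟩ _ ⟨v, hv, hvT, rfl⟩ a b ha hb hab
    refine ⟨a • w + b • v, convex_stdSimplex ℝ _ hw hv ha hb hab, fun i hi => ?_, ?_⟩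
    · simp [hwT i hi, hvT i hi]
    · simp [Finset.smul_sum, add_smul, mul_smul, Finset.sum_add_distrib]
  refine convexHull_min ?_ hS hz
  rintro _ ⟨j, hj, rfl⟩
  refine ⟨Pi.single j 1, single_mem_stdSimplex ℝ j, fun i hi => ?_, ?_⟩
  · exact Pi.single_eq_of_ne (by rintro rfl; exact hi hj) _
  · simp [Pi.single_apply]

theorem eventually_dist_add_smul_lt {E : Type*} [NormedAddCommGroup E] [InnerProductSpace ℝ E]
    {a z v : E} (h : 0 < inner ℝ (a - z) v) :
    ∀ᶠ ε in nhdsWithin (0 : ℝ) (Set.Ioi 0), dist a (z + ε • v) < dist a z := by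
  have h1 : ∀ᶠ ε in nhdsWithin (0 : ℝ) (Set.Ioi 0), ε * ‖v‖ ^ 2 < 2 * inner ℝ (a - z) v := by
    refine (ContinuousAt.eventually_lt (f := fun ε : ℝ => ε * ‖v‖ ^ 2) (by fun_prop)
      continuousAt_const (by simpa using h)).filter_mono nhdsWithin_le_nhds
  filter_upwards [h1, self_mem_nhdsWithin] with ε hε hpos
  have hpos : 0 < ε := hpos
  rw [dist_eq_norm, dist_eq_norm]
  refine lt_of_pow_lt_pow_left₀ 2 (norm_nonneg _) ?_
  rw [← sub_sub, norm_sub_sq_real, inner_smul_right, norm_smul, mul_pow, Real.norm_eq_abs, sq_abs]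
  nlinarith

/-- The contact points `T` alone determine the ball: its center is in their convex hull, so `T`
already has filtration time `R`, and minimality gives `T = J`. -/
theorem isTight_of_minimal {J : Finset (Fin r)} {x : Fin r → EuclideanSpace ℝ (Fin d)}
    (h : Minimal (fun I : Finset (Fin r) => I.Nonempty ∧ cechFiltration I x = cechFiltration J x)
      J) : IsTight J x := by
  classical
  have hJ : J.Nonempty := h.1.1
  obtain ⟨z, hz, hmin⟩ := exists_isLeast_enclosing hJ x
  set R := cechFiltration J x with hR
  set T := J.filter fun j => dist (x j) z = R with hT
  -- Otherwise a hyperplane separates `z` from the hull, and moving `z` slightly towards the hull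
  -- brings all of `J` strictly within distance `R`.
  have hzT : z ∈ convexHull ℝ (x '' (T : Set (Fin r))) := by
    by_contra hcon
    obtain ⟨f, u, hfz, hfu⟩ := geometric_hahn_banach_point_closed (convex_convexHull ℝ _)
      ((T.finite_toSet.image x).isClosed_convexHull (𝕜 := ℝ)) hcon
    set v := (InnerProductSpace.toDual ℝ _).symm f with hv
    have hfv : ∀ a, inner ℝ a v = f a := fun a => by
      rw [real_inner_comm]; exact InnerProductSpace.toDual_symm_apply
    have hev : ∀ᶠ ε in nhdsWithin (0 : ℝ) (Set.Ioi 0), ∀ j ∈ J, dist (x j) (z + ε • v) < R := by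
      rw [Filter.eventually_all_finset]
      intro j hj
      rcases (hz j hj).lt_or_eq with hlt | heq
      · refine (ContinuousAt.eventually_lt (f := fun ε : ℝ => dist (x j) (z + ε • v))
          (by fun_prop) continuousAt_const (by simpa using hlt)).filter_mono nhdsWithin_le_nhds
      · rw [← heq]
        refine eventually_dist_add_smul_lt ?_
        have := hfu (x j) (subset_convexHull ℝ _ ⟨j, by simp [hT, hj, heq], rfl⟩)
        rw [hfv, map_sub]
        linarith
    obtain ⟨ε, hε⟩ := hev.exists
    have h1 := hmin (z + ε • v) (J.sup' hJ fun j => dist (x j) (z + ε • v))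
      fun j hj => Finset.le_sup' (f := fun j => dist (x j) (z + ε • v)) hj
    exact absurd h1 (not_le.2 ((Finset.sup'_lt_iff hJ).2 hε))
  obtain ⟨w, hw, hwT, hzw⟩ := exists_weights_of_mem_convexHull T x hzT
  have hTne : T.Nonempty := by
    by_contra hne
    rw [Finset.not_nonempty_iff_eq_empty] at hne
    have := hw.2
    simp [hwT, hne] at this
  have hTR : R ≤ cechFiltration T x := by
    obtain ⟨y, hy, -⟩ := exists_isLeast_enclosing hTne x
    set ε := cechFiltration T x
    have h0 : 0 ≤ ε := cechFiltration_nonneg _ _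
    refine le_of_sq_le_sq ?_ h0
    -- Averaging these inequalities with the weights `w` cancels the inner products, as `z` is the
    -- barycenter, and leaves `R² ≤ ε²`.
    have hterm : ∀ i, 0 ≤ w i * (ε ^ 2 - R ^ 2 + 2 * inner ℝ (x i - z) (y - z)) := by
      intro i
      by_cases hi : i ∈ T
      · refine mul_nonneg (hw.1 i) ?_
        have h1 : ‖x i - z‖ = R := by rw [← dist_eq_norm]; exact (Finset.mem_filter.1 hi).2
        have h2 := hy i hi
        rw [dist_eq_norm, ← sub_sub_sub_cancel_right _ _ z] at h2
        have h3 := pow_le_pow_left₀ (norm_nonneg _) h2 2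
        rw [norm_sub_sq_real, h1] at h3
        nlinarith [sq_nonneg ‖y - z‖]
      · simp [hwT i hi]
    have hsum := Finset.sum_nonneg fun i (_ : i ∈ Finset.univ) => hterm i
    have hin : ∑ i, w i * inner ℝ (x i - z) (y - z) = 0 := by
      have : ∑ i, w i • (x i - z) = 0 := by
        simp only [smul_sub, Finset.sum_sub_distrib, ← Finset.sum_smul, hw.2, one_smul, ← hzw,
          sub_self]
      simp only [← real_inner_smul_left, ← sum_inner, this, inner_zero_left]
    have : ∑ i, w i * (ε ^ 2 - R ^ 2 + 2 * inner ℝ (x i - z) (y - z))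
        = (∑ i, w i) * (ε ^ 2 - R ^ 2) + 2 * ∑ i, w i * inner ℝ (x i - z) (y - z) := by
      rw [Finset.sum_mul, Finset.mul_sum, ← Finset.sum_add_distrib]
      exact Finset.sum_congr rfl fun i _ => by ring
    rw [this, hin, hw.2] at hsum
    linarith
  have hTJ : T ⊆ J := Finset.filter_subset _ _
  have hJT : J ⊆ T := h.2 ⟨hTne, le_antisymm (cechFiltration_mono hTne hTJ x) hTR⟩ hTJ
  refine ⟨w, hw, fun i hi => hwT i fun h => hi (hTJ h), fun j hj => ?_⟩
  rw [← hzw]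
  exact (Finset.mem_filter.1 (hJT hj)).2

/-- Projecting out the weights preserves closedness because the simplex is compact. This supplies
measurability later. -/
theorem isClosed_setOf_isTight {J : Finset (Fin r)} (hJ : J.Nonempty) :
    IsClosed {x : Fin r → EuclideanSpace ℝ (Fin d) | IsTight J x} := by
  have hφ := continuous_cechFiltration (d := d) hJ
  have : CompactSpace (stdSimplex ℝ (Fin r)) := isCompact_iff_compactSpace.1
    (isCompact_stdSimplex ℝ (Fin r))
  have hw : ∀ i, Continuous
      fun p : stdSimplex ℝ (Fin r) × (Fin r → EuclideanSpace ℝ (Fin d)) => p.1.1 i :=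
    fun i => (continuous_apply i).comp (continuous_subtype_val.comp continuous_fst)
  have hcl : IsClosed {p : stdSimplex ℝ (Fin r) × (Fin r → EuclideanSpace ℝ (Fin d)) |
      (∀ i ∉ J, p.1.1 i = 0) ∧
        ∀ j ∈ J, dist (p.2 j) (∑ i, p.1.1 i • p.2 i) = cechFiltration J p.2} := by
    simp only [Set.ofPred_and, Set.ofPred_forall]
    refine IsClosed.inter ?_ ?_
    · exact isClosed_iInter fun i => isClosed_iInter fun _ =>
        isClosed_eq (hw i) continuous_const
    · exact isClosed_iInter fun i => isClosed_iInter fun _ =>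
        isClosed_eq (Continuous.dist (by fun_prop)
          (continuous_finsetSum _ fun i _ => (hw i).smul (by fun_prop))) (by fun_prop)
  convert isClosedMap_snd_of_compactSpace _ hcl using 1
  ext x
  constructor
  · rintro ⟨w, hw, h1, h2⟩
    exact ⟨(⟨w, hw⟩, x), ⟨h1, h2⟩, rfl⟩
  · rintro ⟨⟨⟨w, hw⟩, x'⟩, ⟨h1, h2⟩, rfl⟩
    exact ⟨w, hw, h1, h2⟩

end Cech

/-! ### Volume of sets with short radial slices -/

section Polar

open MeasureTheory

theorem volumeIoiPow_le_of_dist_le {n : ℕ} {T : Set (Set.Ioi (0 : ℝ))} {D δ : ℝ} (hD : 0 ≤ D)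
    (hTD : ∀ ρ ∈ T, ρ.1 ≤ D) (hT : ∀ ρ ∈ T, ∀ ρ' ∈ T, |ρ.1 - ρ'.1| ≤ δ) :
    Measure.volumeIoiPow n T ≤ ENNReal.ofReal (D ^ n * (2 * δ)) := by
  rcases T.eq_empty_or_nonempty with rfl | ⟨ρ₀, hρ₀⟩
  · simp
  have hδ : 0 ≤ δ := (abs_nonneg _).trans (hT ρ₀ hρ₀ ρ₀ hρ₀)
  -- `T` is enclosed in a measurable interval around one of its points, hence the length `2 * δ`.
  let T' : Set (Set.Ioi (0 : ℝ)) := {ρ | ρ.1 ∈ Set.Icc (ρ₀.1 - δ) (ρ₀.1 + δ) ∧ ρ.1 ≤ D}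
  have hT'm : MeasurableSet T' :=
    (measurable_subtype_coe measurableSet_Icc).inter (measurable_subtype_coe measurableSet_Iic)
  have hsub : T ⊆ T' := fun ρ hρ => by
    have := abs_le.1 (hT ρ hρ ρ₀ hρ₀)
    exact ⟨⟨by linarith, by linarith⟩, hTD ρ hρ⟩
  calc Measure.volumeIoiPow n T ≤ Measure.volumeIoiPow n T' := measure_mono hsub
    _ = ∫⁻ ρ in T', ENNReal.ofReal (ρ.1 ^ n) ∂(Measure.comap Subtype.val volume) := by
        rw [Measure.volumeIoiPow, withDensity_apply _ hT'm]
    _ ≤ ∫⁻ _ in T', ENNReal.ofReal (D ^ n) ∂(Measure.comap Subtype.val volume) := by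
        refine setLIntegral_mono measurable_const fun ρ hρ => ENNReal.ofReal_le_ofReal ?_
        exact pow_le_pow_left₀ (le_of_lt ρ.2) hρ.2 n
    _ = ENNReal.ofReal (D ^ n) * volume (Subtype.val '' T') := by
        rw [setLIntegral_const, comap_subtype_coe_apply measurableSet_Ioi]
    _ ≤ ENNReal.ofReal (D ^ n) * volume (Set.Icc (ρ₀.1 - δ) (ρ₀.1 + δ)) := by
        gcongr
        rintro _ ⟨ρ, hρ, rfl⟩
        exact hρ.1
    _ = ENNReal.ofReal (D ^ n * (2 * δ)) := by
        rw [Real.volume_Icc, ENNReal.ofReal_mul (by positivity)]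
        ring_nf

theorem measure_le_of_radial_dist_le {E : Type*} [NormedAddCommGroup E] [NormedSpace ℝ E]
    [MeasurableSpace E] [BorelSpace E] [FiniteDimensional ℝ E] [Nontrivial E] (μ : Measure E)
    [μ.IsAddHaarMeasure] {S : Set E} (hS : MeasurableSet S) {c : E} {D δ : ℝ} (hD : 0 ≤ D)
    (hSD : ∀ a ∈ S, ‖a - c‖ ≤ D)
    (hδ : ∀ u : E, ‖u‖ = 1 → ∀ ρ ρ' : ℝ, 0 < ρ → 0 < ρ' → c + ρ • u ∈ S → c + ρ' • u ∈ S →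
      |ρ - ρ'| ≤ δ) :
    μ S ≤ μ.toSphere Set.univ * ENNReal.ofReal (D ^ (Module.finrank ℝ E - 1) * (2 * δ)) := by
  let S₀ : Set E := (fun v => c + v) ⁻¹' S
  have hS₀ : MeasurableSet S₀ := hS.preimage (measurable_const_add c)
  have h1 : μ S = μ (S₀ ∩ {0}ᶜ) := by
    rw [← measure_preimage_add μ c S]
    exact (measure_inter_conull (by rw [compl_compl]; exact measure_singleton _)).symm
  let h := homeomorphUnitSphereProd E
  let P : Set (Metric.sphere (0 : E) 1 × Set.Ioi (0 : ℝ)) :=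
    {p | c + p.2.1 • p.1.1 ∈ S}
  have hP : MeasurableSet P := by
    refine hS.preimage (Continuous.measurable ?_)
    fun_prop
  have h2 : μ (S₀ ∩ {0}ᶜ) = μ.comap (Subtype.val : ({0}ᶜ : Set E) → E) (h ⁻¹' P) := by
    rw [comap_subtype_coe_apply (measurableSet_singleton _).compl]
    congr 1
    ext v
    have key : ∀ v : ({0}ᶜ : Set E), v.1 ∈ S₀ ↔ h v ∈ P := by
      intro v
      have : v.1 = (h v).2.1 • (h v).1.1 := by
        conv_lhs => rw [← h.symm_apply_apply v]
        rfl
      change c + v.1 ∈ S ↔ c + (h v).2.1 • (h v).1.1 ∈ S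
      rw [← this]
    constructor
    · rintro ⟨hv, hv0⟩
      exact ⟨⟨v, hv0⟩, (key _).1 hv, rfl⟩
    · rintro ⟨v, hv, rfl⟩
      exact ⟨(key v).2 hv, v.2⟩
  rw [h1, h2, μ.measurePreserving_homeomorphUnitSphereProd.measure_preimage hP.nullMeasurableSet,
    Measure.prod_apply hP, mul_comm, ← lintegral_const]
  refine lintegral_mono fun u => volumeIoiPow_le_of_dist_le hD ?_ ?_
  · intro ρ hρ
    have := hSD _ hρ
    have hu : ‖u.1‖ = 1 := by simp
    rwa [add_sub_cancel_left, norm_smul, hu, mul_one, Real.norm_eq_abs,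
      abs_of_pos (show 0 < ρ.1 from ρ.2)] at this
  · intro ρ hρ ρ' hρ'
    exact hδ u (by simp) ρ ρ' ρ.2 ρ'.2 hρ hρ'

end Polar

/-! ### How the enclosing radius controls one vertex along a ray -/

section Radial

theorem inner_eq_zero_of_mem_vectorSpan {ι E : Type*} [NormedAddCommGroup E]
    [InnerProductSpace ℝ E] {K : Set ι} {x : ι → E} {c z : E} {ρ R : ℝ}
    (hc : ∀ j ∈ K, dist (x j) c = ρ) (hz : ∀ j ∈ K, dist (x j) z = R) :
    z - c ∈ (vectorSpan ℝ (x '' K))ᗮ := by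
  refine (Submodule.mem_orthogonal' _ _).2 fun u hu => ?_
  rw [vectorSpan_def] at hu
  induction hu using Submodule.span_induction with
  | mem u hu =>
    obtain ⟨_, ⟨i, hi, rfl⟩, _, ⟨j, hj, rfl⟩, rfl⟩ := hu
    exact EuclideanGeometry.inner_vsub_vsub_of_dist_eq_of_dist_eq
      ((hc j hj).trans (hc i hi).symm) ((hz j hj).trans (hz i hi).symm)
  | zero => exact inner_zero_right _
  | add a b _ _ ha hb => rw [inner_add_right, ha, hb, add_zero]
  | smul t a _ ha => rw [inner_smul_right, ha, mul_zero]

variable {d r : ℕ}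

/-- Project the center of the ball of `J` onto the affine span of the remaining vertices; Pythagoras
makes the result equidistant from them. -/
theorem IsTight.exists_circumcenter {J : Finset (Fin r)} {x : Fin r → EuclideanSpace ℝ (Fin d)}
    (h : IsTight J x) {k : Fin r} (hJ : (J.erase k).Nonempty) :
    ∃ c ρ, 0 ≤ ρ ∧ ρ ≤ cechFiltration J x ∧ ∀ j ∈ J.erase k,
      x j - c ∈ vectorSpan ℝ (x '' (J.erase k : Finset (Fin r))) ∧ dist (x j) c = ρ := by
  obtain ⟨w, -, -, hz⟩ := h
  set z := ∑ i, w i • x i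
  set R := cechFiltration J x
  set W := vectorSpan ℝ (x '' (J.erase k : Finset (Fin r))) with hW
  obtain ⟨j₀, hj₀⟩ := hJ
  set c := x j₀ + W.starProjection (z - x j₀) with hc
  have hmem : ∀ j ∈ J.erase k, x j - c ∈ W := fun j hj => by
    rw [hc, ← sub_sub]
    exact W.sub_mem (vsub_mem_vectorSpan ℝ ⟨j, hj, rfl⟩ ⟨j₀, hj₀, rfl⟩)
      (W.starProjection_apply_mem _)
  have hzc : z - c ∈ Wᗮ := by
    rw [hc, ← sub_sub]
    exact W.sub_starProjection_mem_orthogonal _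
  have hsq : ∀ j ∈ J.erase k, dist (x j) c ^ 2 = R ^ 2 - ‖z - c‖ ^ 2 := fun j hj => by
    have h1 := hz j (Finset.mem_of_mem_erase hj)
    rw [dist_eq_norm, ← sub_sub_sub_cancel_right _ _ c] at h1
    have h2 := norm_sub_sq_real (x j - c) (z - c)
    rw [h1, Submodule.inner_right_of_mem_orthogonal (hmem j hj) hzc] at h2
    rw [dist_eq_norm]
    linarith
  refine ⟨c, dist (x j₀) c, dist_nonneg, ?_, fun j hj => ⟨hmem j hj, ?_⟩⟩
  · refine le_of_sq_le_sq ?_ (cechFiltration_nonneg _ _)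
    rw [hsq j₀ hj₀]
    linarith [sq_nonneg ‖z - c‖]
  · rw [← sq_eq_sq₀ dist_nonneg dist_nonneg, hsq j hj, hsq j₀ hj₀]

theorem IsTight.exists_radial_eq {J : Finset (Fin r)} {x : Fin r → EuclideanSpace ℝ (Fin d)}
    (h : IsTight J x) {k : Fin r} (hk : k ∈ J) (hJ : (J.erase k).Nonempty)
    {W : Submodule ℝ (EuclideanSpace ℝ (Fin d))}
    (hW : W = vectorSpan ℝ (x '' (J.erase k : Finset (Fin r))))
    {c : EuclideanSpace ℝ (Fin d)} {ρ : ℝ}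
    (hc : ∀ j ∈ J.erase k, x j - c ∈ W ∧ dist (x j) c = ρ) :
    ∃ s, 0 ≤ s ∧ s ^ 2 = cechFiltration J x ^ 2 - ρ ^ 2 ∧
      ‖x k - c‖ ^ 2 - 2 * s * ‖Wᗮ.starProjection (x k - c)‖ = ρ ^ 2 := by
  obtain ⟨w, hw, hwJ, hz⟩ := h
  set z := ∑ i, w i • x i with hzdef
  set R := cechFiltration J x
  have hzc : z - c ∈ Wᗮ := hW ▸ inner_eq_zero_of_mem_vectorSpan (fun j hj => (hc j hj).2)
    (fun j hj => hz j (Finset.mem_of_mem_erase hj))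
  -- Projecting the convex combination onto `Wᗮ` kills every vertex except `x k`. Since `w k ≥ 0`,
  -- the two vectors point the same way.
  have hzq : z - c = w k • Wᗮ.starProjection (x k - c) := by
    have h1 : z - c = ∑ i, w i • (x i - c) := by
      simp only [smul_sub, Finset.sum_sub_distrib, ← Finset.sum_smul, hw.2, one_smul, hzdef]
    conv_lhs => rw [← Submodule.starProjection_eq_self_iff.2 hzc, h1, map_sum]
    rw [Finset.sum_eq_single k]
    · rw [map_smul]
    · intro i _ hik
      by_cases hi : i ∈ J
      · rw [map_smul, W.starProjection_orthogonal_apply_eq_zero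
          (hc i (Finset.mem_erase.2 ⟨hik, hi⟩)).1, smul_zero]
      · rw [hwJ i hi, zero_smul, map_zero]
    · simp
  have hs : ‖z - c‖ = w k * ‖Wᗮ.starProjection (x k - c)‖ := by
    rw [hzq, norm_smul, Real.norm_eq_abs, abs_of_nonneg (hw.1 k)]
  have hin : inner ℝ (x k - c) (z - c) = ‖z - c‖ * ‖Wᗮ.starProjection (x k - c)‖ := by
    rw [← Submodule.starProjection_eq_self_iff.2 hzc, ← Submodule.inner_starProjection_left_eq_right,
      Submodule.starProjection_eq_self_iff.2 hzc, hs]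
    conv_lhs => rw [hzq]
    rw [inner_smul_right, real_inner_self_eq_norm_sq]
    ring
  obtain ⟨j, hj⟩ := hJ
  refine ⟨‖z - c‖, norm_nonneg _, ?_, ?_⟩
  · have h1 := hz j (Finset.mem_of_mem_erase hj)
    rw [dist_eq_norm, ← sub_sub_sub_cancel_right _ _ c] at h1
    have h2 := norm_sub_sq_real (x j - c) (z - c)
    have h3 := (hc j hj).2
    rw [dist_eq_norm] at h3
    rw [h1, h3, Submodule.inner_right_of_mem_orthogonal (hc j hj).1 hzc] at h2
    linarith
  · have h1 := hz k hk
    rw [dist_eq_norm, ← sub_sub_sub_cancel_right _ _ c] at h1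
    have h2 := norm_sub_sq_real (x k - c) (z - c)
    have h1' := hz j (Finset.mem_of_mem_erase hj)
    rw [dist_eq_norm, ← sub_sub_sub_cancel_right _ _ c] at h1'
    have h2' := norm_sub_sq_real (x j - c) (z - c)
    have h3 := (hc j hj).2
    rw [dist_eq_norm] at h3
    rw [h1', h3, Submodule.inner_right_of_mem_orthogonal (hc j hj).1 hzc] at h2'
    rw [h1, hin] at h2
    linarith

theorem abs_sub_le_of_radial_eq {a b s s' q p : ℝ} (ha : 0 < a) (hb : 0 < b)
    (hq0 : 0 ≤ q) (hq1 : q ≤ 1) (h : a ^ 2 - 2 * s * (a * q) = p ^ 2)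
    (h' : b ^ 2 - 2 * s' * (b * q) = p ^ 2) : |a - b| ≤ 2 * |s - s'| := by
  have key : (a - b) * (a * b + p ^ 2) = 2 * (s - s') * q * (a * b) := by
    linear_combination b * h - a * h'
  have hab : 0 < a * b := mul_pos ha hb
  have h1 : |a - b| * (a * b + p ^ 2) = 2 * |s - s'| * q * (a * b) := by
    have := congrArg abs key
    rwa [abs_mul, abs_mul, abs_mul, abs_mul, abs_of_pos (by positivity : 0 < a * b + p ^ 2),
      abs_of_nonneg hq0, abs_of_pos hab, abs_two] at this
  have h2 : |a - b| * (a * b) ≤ 2 * |s - s'| * (a * b) := by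
    have : 0 ≤ |a - b| * p ^ 2 := by positivity
    have : 2 * |s - s'| * q ≤ 2 * |s - s'| := mul_le_of_le_one_right (by positivity) hq1
    nlinarith
  exact le_of_mul_le_mul_right h2 hab

/-- The only source of the exponent 1/2: near `s = 0`, a bound on `s ^ 2` controls `s` no better. -/
theorem sq_abs_sub_le_abs_sq_sub {s s' : ℝ} (hs : 0 ≤ s) (hs' : 0 ≤ s') :
    |s - s'| ^ 2 ≤ |s ^ 2 - s' ^ 2| := by
  rw [sq_sub_sq, abs_mul, sq, abs_of_nonneg (add_nonneg hs hs')]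
  refine mul_le_mul_of_nonneg_right ?_ (abs_nonneg _)
  exact abs_sub_le_iff.2 ⟨by linarith, by linarith⟩

theorem abs_radius_sub_le {J : Finset (Fin r)} {x x' : Fin r → EuclideanSpace ℝ (Fin d)}
    {k : Fin r} (hk : k ∈ J) (hJ : (J.erase k).Nonempty) (hxx' : ∀ j ≠ k, x j = x' j)
    (hx : IsTight J x) (hx' : IsTight J x') {W : Submodule ℝ (EuclideanSpace ℝ (Fin d))}
    (hW : W = vectorSpan ℝ (x '' (J.erase k : Finset (Fin r))))
    {c u : EuclideanSpace ℝ (Fin d)} {ρ a b : ℝ}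
    (hc : ∀ j ∈ J.erase k, x j - c ∈ W ∧ dist (x j) c = ρ) (hu : ‖u‖ = 1)
    (ha : 0 < a) (hb : 0 < b) (hxa : x k = c + a • u) (hxb : x' k = c + b • u)
    {D t : ℝ} (hD : cechFiltration J x ≤ D) (hD' : cechFiltration J x' ≤ D)
    (ht : |cechFiltration J x - cechFiltration J x'| ≤ t) :
    |a - b| ≤ 2 * √(2 * D * t) := by
  have hW' : W = vectorSpan ℝ (x' '' (J.erase k : Finset (Fin r))) := by
    rw [hW]
    congr 1
    exact Set.image_congr fun j hj => hxx' j (Finset.ne_of_mem_erase hj)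
  have hc' : ∀ j ∈ J.erase k, x' j - c ∈ W ∧ dist (x' j) c = ρ := fun j hj => by
    rw [← hxx' j (Finset.ne_of_mem_erase hj)]; exact hc j hj
  obtain ⟨s, hs, hs2, h1⟩ := hx.exists_radial_eq hk hJ hW hc
  obtain ⟨s', hs', hs2', h1'⟩ := hx'.exists_radial_eq hk hJ hW' hc'
  rw [hxa, add_sub_cancel_left, map_smul, norm_smul, norm_smul, hu, mul_one, Real.norm_eq_abs,
    abs_of_pos ha] at h1
  rw [hxb, add_sub_cancel_left, map_smul, norm_smul, norm_smul, hu, mul_one, Real.norm_eq_abs,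
    abs_of_pos hb] at h1'
  have hq1 : ‖Wᗮ.starProjection u‖ ≤ 1 := hu ▸ Wᗮ.norm_starProjection_apply_le u
  refine (abs_sub_le_of_radial_eq ha hb (norm_nonneg _) hq1 h1 h1').trans ?_
  refine mul_le_mul_of_nonneg_left (Real.le_sqrt_of_sq_le ?_) zero_le_two
  refine (sq_abs_sub_le_abs_sq_sub hs hs').trans ?_
  have h0 := cechFiltration_nonneg J x
  have h0' := cechFiltration_nonneg J x'
  rw [hs2, hs2', sub_sub_sub_cancel_right, sq_sub_sq, abs_mul, abs_of_nonneg (add_nonneg h0 h0')]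
  exact mul_le_mul (by linarith) ht (abs_nonneg _) (by linarith)

end Radial

/-! ### From small stability radius to small gaps, and their measure -/

section Gaps

open MeasureTheory

variable {d r : ℕ}

theorem cechFiltration_congr {I : Finset (Fin r)} {x y : Fin r → EuclideanSpace ℝ (Fin d)}
    (h : ∀ i ∈ I, x i = y i) : cechFiltration I x = cechFiltration I y := by
  unfold cechFiltration
  congr 1
  ext ε
  refine and_congr_right fun _ => ?_
  rw [Set.iInter₂_congr fun i hi => by rw [h i hi]]

/-- Point clouds in `M` for which the filtration times of `I` and `J` differ by at most `t`
and `J` is tight. -/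
def narrowGap (M : Set (EuclideanSpace ℝ (Fin d))) (I J : Finset (Fin r)) (t : ℝ) :
    Set (Fin r → EuclideanSpace ℝ (Fin d)) :=
  {x | (∀ i, x i ∈ M) ∧ IsTight J x ∧ |cechFiltration I x - cechFiltration J x| ≤ t}

theorem isClosed_narrowGap {M : Set (EuclideanSpace ℝ (Fin d))} (hM : IsClosed M)
    {I J : Finset (Fin r)} (hI : I.Nonempty) (hJ : J.Nonempty) (t : ℝ) :
    IsClosed (narrowGap M I J t) := by
  have h1 := continuous_cechFiltration (d := d) hI
  have h2 := continuous_cechFiltration (d := d) hJ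
  have hcl : IsClosed {x : Fin r → EuclideanSpace ℝ (Fin d) | ∀ i, x i ∈ M} := by
    rw [Set.ofPred_forall]
    exact isClosed_iInter fun i => hM.preimage (continuous_apply i)
  exact hcl.inter ((isClosed_setOf_isTight hJ).inter
    (isClosed_le (h1.sub h2).abs continuous_const))

/-- `c` and `ρ` depend only on the fixed vertices, so they serve the whole section. The time of `I`
is constant there, so two times of `J` differ by at most `2 * t`. -/
theorem volume_section_narrowGap_le [NeZero d] {n : ℕ} {M : Set (EuclideanSpace ℝ (Fin d))}
    (hM : IsClosed M) {D t : ℝ} (hD0 : 0 ≤ D) (hD : ∀ a ∈ M, ∀ b ∈ M, dist a b ≤ D)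
    {I J : Finset (Fin (n + 1))} {k : Fin (n + 1)} (hI : I.Nonempty) (hkI : k ∉ I) (hkJ : k ∈ J)
    (hJk : (J.erase k).Nonempty) (y : Fin n → EuclideanSpace ℝ (Fin d)) :
    volume {v | (k.insertNth v y : Fin (n + 1) → EuclideanSpace ℝ (Fin d)) ∈ narrowGap M I J t} ≤
      (volume : Measure (EuclideanSpace ℝ (Fin d))).toSphere Set.univ *
        ENNReal.ofReal ((2 * D) ^ (d - 1) * (2 * (2 * √(2 * D * (2 * t))))) := by
  set S := {v | (k.insertNth v y : Fin (n + 1) → EuclideanSpace ℝ (Fin d)) ∈ narrowGap M I J t}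
    with hSdef
  have hJ : J.Nonempty := ⟨k, hkJ⟩
  have hcont : Continuous fun v : EuclideanSpace ℝ (Fin d) =>
      (k.insertNth v y : Fin (n + 1) → EuclideanSpace ℝ (Fin d)) :=
    Continuous.finInsertNth (A := fun _ => EuclideanSpace ℝ (Fin d)) k continuous_id
      continuous_const
  have hS : MeasurableSet S := ((isClosed_narrowGap hM hI hJ t).preimage hcont).measurableSet
  have hne : ∀ v w : EuclideanSpace ℝ (Fin d), ∀ j ≠ k,
      (k.insertNth v y : Fin (n + 1) → EuclideanSpace ℝ (Fin d)) j =
        (k.insertNth w y : Fin (n + 1) → EuclideanSpace ℝ (Fin d)) j := by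
    intro v w j hj
    obtain ⟨i, rfl⟩ := Fin.exists_succAbove_eq hj
    simp
  rcases S.eq_empty_or_nonempty with hemp | ⟨v₀, hv₀⟩
  · simp [hemp]
  obtain ⟨hM₀, ht₀, -⟩ := id hv₀
  set x₀ : Fin (n + 1) → EuclideanSpace ℝ (Fin d) := k.insertNth v₀ y with hx₀
  obtain ⟨c, ρ, -, hρR, hc⟩ := ht₀.exists_circumcenter hJk
  have hR : ∀ v ∈ S, cechFiltration J (k.insertNth v y : Fin (n + 1) → _) ≤ D := fun v hv =>
    cechFiltration_le_of_mem hJ fun i j => hD _ (hv.1 i) _ (hv.1 j)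
  -- One `D` from `v` to a fixed vertex, another from that vertex to `c`, as `ρ` is at most the
  -- filtration time of `J`.
  have hSc : ∀ v ∈ S, ‖v - c‖ ≤ 2 * D := by
    intro v hv
    obtain ⟨j, hj⟩ := hJk
    have h1 := hD _ (hv.1 k) _ (hM₀ j)
    rw [Fin.insertNth_apply_same] at h1
    have h2 := (hc j hj).2
    have h3 := hR v₀ hv₀
    rw [← dist_eq_norm]
    linarith [dist_triangle v (x₀ j) c]
  have hmain := measure_le_of_radial_dist_le (volume : Measure (EuclideanSpace ℝ (Fin d))) hS
    (c := c) (D := 2 * D) (δ := 2 * √(2 * D * (2 * t))) (by linarith) hSc ?_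
  · simpa using hmain
  intro u hu a b ha hb hSa hSb
  have hW : vectorSpan ℝ (x₀ '' (J.erase k : Finset (Fin (n + 1)))) =
      vectorSpan ℝ ((k.insertNth (c + a • u) y : Fin (n + 1) → EuclideanSpace ℝ (Fin d)) ''
        (J.erase k : Finset (Fin (n + 1)))) := by
    congr 1
    exact Set.image_congr fun j hj => hne _ _ j (Finset.ne_of_mem_erase hj)
  refine abs_radius_sub_le hkJ hJk (hne _ _) hSa.2.1 hSb.2.1 hW (c := c) (ρ := ρ) (u := u) ?_ hu
    ha hb (Fin.insertNth_apply_same ..) (Fin.insertNth_apply_same ..) (hR _ hSa) (hR _ hSb) ?_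
  · intro j hj
    rw [hne (c + a • u) v₀ j (Finset.ne_of_mem_erase hj)]
    exact hc j hj
  · have h1 := abs_le.1 hSa.2.2
    have h2 := abs_le.1 hSb.2.2
    rw [cechFiltration_congr (I := I) fun i hi =>
      hne (c + a • u) (c + b • u) i fun h => hkI (h ▸ hi)] at h1
    exact abs_le.2 ⟨by linarith, by linarith⟩

theorem exists_volume_narrowGap_le [NeZero d] {M : Set (EuclideanSpace ℝ (Fin d))}
    (hM : IsCompact M) (r : ℕ) :
    ∃ C : ℝ≥0, ∀ (I J : Finset (Fin r)) (k : Fin r), I.Nonempty → k ∉ I → k ∈ J →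
      (J.erase k).Nonempty → ∀ t : ℝ, 0 ≤ t →
        volume (narrowGap M I J (2 * t)) ≤ (C : ℝ≥0∞) * ENNReal.ofReal (√t) := by
  rcases r with - | n
  · exact ⟨0, fun _ _ k => k.elim0⟩
  obtain ⟨D, hD0, hD⟩ : ∃ D, 0 ≤ D ∧ ∀ a ∈ M, ∀ b ∈ M, dist a b ≤ D :=
    ⟨Metric.diam M, Metric.diam_nonneg, fun a ha b hb =>
      Metric.dist_le_diam_of_mem hM.isBounded ha hb⟩
  set Y : Set (Fin n → EuclideanSpace ℝ (Fin d)) := Set.univ.pi fun _ => M with hY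
  have hYc : IsCompact Y := isCompact_univ_pi fun _ => hM
  set C₁ : ℝ≥0∞ := (volume : Measure (EuclideanSpace ℝ (Fin d))).toSphere Set.univ *
    ENNReal.ofReal ((2 * D) ^ (d - 1) * (2 * (2 * √(8 * D)))) * volume Y with hC₁
  have hC₁top : C₁ ≠ ⊤ := ENNReal.mul_ne_top
    (ENNReal.mul_ne_top (measure_ne_top _ _) ENNReal.ofReal_ne_top) hYc.measure_lt_top.ne
  refine ⟨C₁.toNNReal, fun I J k hI hkI hkJ hJk t ht => ?_⟩
  rw [ENNReal.coe_toNNReal hC₁top]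
  have hA : MeasurableSet (narrowGap M I J (2 * t)) :=
    (isClosed_narrowGap hM.isClosed hI ⟨k, hkJ⟩ _).measurableSet
  set e := MeasurableEquiv.piFinSuccAbove (fun _ : Fin (n + 1) => EuclideanSpace ℝ (Fin d)) k
  have hmp : MeasurePreserving e.symm :=
    (volume_preserving_piFinSuccAbove (fun _ : Fin (n + 1) => EuclideanSpace ℝ (Fin d)) k).symm
  rw [← hmp.measure_preimage hA.nullMeasurableSet, Measure.volume_eq_prod,
    Measure.prod_apply_symm (e.symm.measurable hA)]
  calc _ ≤ ∫⁻ y, Y.indicator (fun _ =>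
        (volume : Measure (EuclideanSpace ℝ (Fin d))).toSphere Set.univ *
        ENNReal.ofReal ((2 * D) ^ (d - 1) * (2 * (2 * √(2 * D * (2 * (2 * t))))))) y := by
        refine lintegral_mono fun y => ?_
        by_cases hy : y ∈ Y
        · rw [Set.indicator_of_mem hy]
          exact volume_section_narrowGap_le hM.isClosed hD0 hD hI hkI hkJ hJk y
        · rw [Set.indicator_of_notMem hy, nonpos_iff_eq_zero]
          refine (congrArg _ ?_).trans (measure_empty (μ := volume))
          refine Set.eq_empty_of_forall_notMem fun v hv => hy fun i _ => ?_
          have : (k.insertNth v y : Fin (n + 1) → EuclideanSpace ℝ (Fin d)) (k.succAbove i) ∈ M :=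
            hv.1 (k.succAbove i)
          simpa using this
    _ = C₁ * ENNReal.ofReal (√t) := by
        rw [lintegral_indicator_const hYc.measurableSet, hC₁,
          show 2 * D * (2 * (2 * t)) = 8 * D * t by ring, Real.sqrt_mul (by positivity),
          show (2 * D) ^ (d - 1) * (2 * (2 * (√(8 * D) * √t))) =
            (2 * D) ^ (d - 1) * (2 * (2 * √(8 * D))) * √t by ring,
          ENNReal.ofReal_mul (by positivity)]
        ring

theorem exists_small_gap_of_stabilityRadius_le {x : Fin r → EuclideanSpace ℝ (Fin d)}
    (S : FiltrationOrder cechFiltration x) {t : ℝ} (ht : 0 ≤ t)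
    (h : stabilityRadius cechFiltration x S ≤ ENNReal.ofReal t) :
    ∃ a b, a < b ∧ cechFiltration (S.J b) x - cechFiltration (S.J a) x ≤ 2 * t := by
  by_contra! hcon
  -- Both times in a gap can move by `ε`. If all gaps exceed `2 * t`, finiteness leaves room for
  -- some `ε > t`, contradicting the bound on the radius.
  have hev : ∀ᶠ ε in nhdsWithin t (Set.Ioi t), ∀ a b, a < b →
      2 * ε < cechFiltration (S.J b) x - cechFiltration (S.J a) x := by
    simp only [Filter.eventually_all]
    intro a b hab
    exact (ContinuousAt.eventually_lt (f := fun ε : ℝ => 2 * ε) (by fun_prop)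
      continuousAt_const (hcon a b hab)).filter_mono nhdsWithin_le_nhds
  obtain ⟨ε, hε, htε⟩ := (hev.and self_mem_nhdsWithin).exists
  have htε : t < ε := htε
  have hle : ENNReal.ofReal ε ≤ stabilityRadius cechFiltration x S := by
    refine le_iSup₂_of_le ε.toNNReal (fun y hy a b hab => ?_) le_rfl
    rw [Real.coe_toNNReal _ (ht.trans htε.le)] at hy
    have h1 := cechFiltration_le_add (S.minimal a).1.1 fun i => Metric.mem_closedBall.1 (hy i)
    have h2 := cechFiltration_le_add (S.minimal b).1.1 fun i => Metric.mem_closedBall'.1 (hy i)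
    have h3 := hε a b hab
    change cechFiltration (S.J a) y < cechFiltration (S.J b) y
    linarith
  exact absurd (hle.trans h) (not_le.2 (ENNReal.ofReal_lt_ofReal_iff_of_nonneg ht |>.2 htε))

theorem Finset.exists_mem_erase_nonempty_of_card_le {α : Type*} [DecidableEq α] {I J : Finset α}
    (hJ : 1 < J.card) (hIJ : I.card ≤ J.card) (hne : I ≠ J) :
    ∃ k ∈ J, k ∉ I ∧ (J.erase k).Nonempty := by
  obtain ⟨k, hkJ, hkI⟩ : ∃ k ∈ J, k ∉ I := by
    by_contra! hsub
    exact hne (Finset.eq_of_subset_of_card_le hsub hIJ).symm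
  refine ⟨k, hkJ, hkI, Finset.card_pos.1 ?_⟩
  rw [Finset.card_erase_of_mem hkJ]
  omega

theorem exists_mem_narrowGap_of_stabilityRadius_le {M : Set (EuclideanSpace ℝ (Fin d))}
    {x : Fin r → EuclideanSpace ℝ (Fin d)} (hx : ∀ i, x i ∈ M)
    (S : FiltrationOrder cechFiltration x) {t : ℝ} (ht : 0 ≤ t)
    (h : stabilityRadius cechFiltration x S ≤ ENNReal.ofReal t) :
    ∃ (I J : Finset (Fin r)) (k : Fin r), I.Nonempty ∧ k ∉ I ∧ k ∈ J ∧ (J.erase k).Nonempty ∧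
      x ∈ narrowGap M I J (2 * t) := by
  obtain ⟨a, b, hab, hgap⟩ := exists_small_gap_of_stabilityRadius_le S ht h
  have hlt : cechFiltration (S.J a) x < cechFiltration (S.J b) x := S.strictMono hab
  have hne : S.J a ≠ S.J b := fun h => hlt.ne (by rw [h])
  have ha := (S.minimal a).1.1
  have hb := (S.minimal b).1.1
  -- Singletons have time 0, which cannot be the larger of two distinct times.
  have hcardb : 1 < (S.J b).card := by
    by_contra! hcard
    obtain ⟨j, hj⟩ := Finset.card_eq_one.1 (le_antisymm hcard (Finset.card_pos.2 hb))
    rw [hj, cechFiltration_singleton] at hlt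
    exact absurd hlt (not_lt.2 (cechFiltration_nonneg _ _))
  rcases le_total (S.J a).card (S.J b).card with hle | hle
  · obtain ⟨k, hk, hk', hk''⟩ := Finset.exists_mem_erase_nonempty_of_card_le hcardb hle hne
    refine ⟨S.J a, S.J b, k, ha, hk', hk, hk'', hx, isTight_of_minimal (S.minimal b), ?_⟩
    exact abs_le.2 ⟨by linarith, by linarith⟩
  · obtain ⟨k, hk, hk', hk''⟩ :=
      Finset.exists_mem_erase_nonempty_of_card_le (hcardb.trans_le hle) hle hne.symm
    refine ⟨S.J b, S.J a, k, hb, hk', hk, hk'', hx, isTight_of_minimal (S.minimal a), ?_⟩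
    exact abs_le.2 ⟨by linarith, by linarith⟩

theorem cechFiltration_eq_zero_of_subsingleton [Subsingleton (EuclideanSpace ℝ (Fin d))]
    {J : Finset (Fin r)} (hJ : J.Nonempty) (x : Fin r → EuclideanSpace ℝ (Fin d)) :
    cechFiltration J x = 0 :=
  le_antisymm (cechFiltration_le_of_forall_dist_le hJ (y := 0) fun j _ => by
    rw [Subsingleton.elim (x j) 0, dist_self]) (cechFiltration_nonneg _ _)

end Gaps

theorem corollary2 {d r : ℕ} (M : Set (EuclideanSpace ℝ (Fin d)))
    (hM_compact : IsCompact M) (hM_convex : Convex ℝ M) (hM_full : (interior M).Nonempty) :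
    ∃ C : ℝ≥0, ∀ S : (x : Fin r → EuclideanSpace ℝ (Fin d)) → FiltrationOrder cechFiltration x,
      ∀ t ∈ Set.Icc (0 : ℝ) 1,
        MeasureTheory.volume {x : Fin r → EuclideanSpace ℝ (Fin d) |
            (∀ i, x i ∈ M) ∧ stabilityRadius cechFiltration x (S x) ≤ ENNReal.ofReal t}
          ≤ (C : ℝ≥0∞) * ENNReal.ofReal (√t) := by
  -- Polar coordinates need positive dimension. For `d = 0` all times vanish, so no two distinct
  -- values exist and the set is empty.
  rcases d.eq_zero_or_pos with rfl | hd
  · refine ⟨0, fun S t ht => ?_⟩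
    refine ((congrArg _ ?_).trans MeasureTheory.measure_empty).trans_le zero_le
    refine Set.eq_empty_of_forall_notMem fun x hx => ?_
    obtain ⟨a, b, hab, -⟩ := exists_small_gap_of_stabilityRadius_le (S x) ht.1 hx.2
    refine ((S x).strictMono hab).ne ?_
    simp only [cechFiltration_eq_zero_of_subsingleton ((S x).minimal _).1.1]
  have : NeZero d := ⟨hd.ne'⟩
  obtain ⟨C, hC⟩ := exists_volume_narrowGap_le hM_compact r
  -- The triples range over all admissible index sets, independently of `S`, so the constant does
  -- not depend on the representatives.
  let P := {p : Finset (Fin r) × Finset (Fin r) × Fin r //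
    p.1.Nonempty ∧ p.2.2 ∉ p.1 ∧ p.2.2 ∈ p.2.1 ∧ (p.2.1.erase p.2.2).Nonempty}
  refine ⟨Fintype.card P * C, fun S t ht => ?_⟩
  calc _ ≤ MeasureTheory.volume (⋃ p : P, narrowGap M p.1.1 p.1.2.1 (2 * t)) := by
        refine MeasureTheory.measure_mono fun x hx => ?_
        obtain ⟨I, J, k, h1, h2, h3, h4, h5⟩ :=
          exists_mem_narrowGap_of_stabilityRadius_le hx.1 (S x) ht.1 hx.2
        exact Set.mem_iUnion.2 ⟨⟨(I, J, k), h1, h2, h3, h4⟩, h5⟩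
    _ ≤ ∑ p : P, MeasureTheory.volume (narrowGap M p.1.1 p.1.2.1 (2 * t)) :=
        MeasureTheory.measure_iUnion_fintype_le _ _
    _ ≤ ∑ _p : P, (C : ℝ≥0∞) * ENNReal.ofReal (√t) :=
        Finset.sum_le_sum fun p _ => hC _ _ p.1.2.2 p.2.1 p.2.2.1 p.2.2.2.1 p.2.2.2.2 t ht.1
    _ = _ := by
        rw [Finset.sum_const, nsmul_eq_mul, Finset.card_univ]
        push_cast
        ring
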